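/- Let $H_3$ be the discrete three-dimensional Heisenberg group, that is, the group under matrix multiplication $$H_3 = \left\{ \begin{pmatrix} 1 & a & c \\ 0 & 1 & b \\ 0 & 0 & 1 \end{pmatrix} : a, b, c \in \mathbf{Z} \right\},$$ and let $\mathbf{C}$ be the trivial $H_3$-module. Then the group cohomology of $H_3$ with coefficients in $\mathbf{C}$ is given, up to isomorphism of complex vector spaces, by $$H^n(H_3; \mathbf{C}) \cong \begin{cases} \mathbf{C} & n = 0, \\ \mathbf{C}^2 & n = 1, \\ \mathbf{C}^2 & n = 2, \\ \mathbf{C} & n = 3, \\ 0 & n > 3. \end{cases}$$ -/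

import Mathlib

open scoped MatrixGroups

/-- The integer matrix with rows `(1, a, c)`, `(0, 1, b)`, `(0, 0, 1)`. -/
def heisenbergMatrix (a b c : ℤ) : Matrix (Fin 3) (Fin 3) ℤ :=
  !![1, a, c; 0, 1, b; 0, 0, 1]

theorem heisenbergMatrix_zero : heisenbergMatrix 0 0 0 = 1 := by
  ext i j
  fin_cases i <;> fin_cases j <;> simp [heisenbergMatrix]

theorem heisenbergMatrix_mul (a b c a' b' c' : ℤ) :
    heisenbergMatrix a b c * heisenbergMatrix a' b' c' =
      heisenbergMatrix (a + a') (b + b') (c + c' + a * b') := by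
  ext i j
  fin_cases i <;> fin_cases j <;>
    simp [heisenbergMatrix, Matrix.mul_apply, Fin.sum_univ_three] <;> ring

/-- The discrete three-dimensional Heisenberg group: the group, under matrix multiplication, of
all integer upper triangular `3 × 3` matrices with ones on the diagonal, as a subgroup of
`GL(3, ℤ)`. -/
def HeisenbergGroup : Subgroup (GL (Fin 3) ℤ) where
  carrier := {g | ∃ a b c : ℤ, (g : Matrix (Fin 3) (Fin 3) ℤ) = heisenbergMatrix a b c}
  mul_mem' := by
    rintro g h ⟨a, b, c, hg⟩ ⟨a', b', c', hh⟩
    exact ⟨a + a', b + b', c + c' + a * b', by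
      rw [Units.val_mul, hg, hh, heisenbergMatrix_mul]⟩
  one_mem' := ⟨0, 0, 0, by rw [Units.val_one, heisenbergMatrix_zero]⟩
  inv_mem' := by
    rintro g ⟨a, b, c, hg⟩
    refine ⟨-a, -b, a * b - c, ?_⟩
    refine Units.inv_eq_of_mul_eq_one_right ?_
    rw [hg, heisenbergMatrix_mul, ← heisenbergMatrix_zero]
    congr 1 <;> ring

/-!
For a homomorphism `π : G →* Q`, the group `G` acts on the functions `Q → k` by right translation
through `π`, and the left translations by elements of `Q` commute with this action. If
`p : Q →* Q'` is surjective with infinite cyclic kernel `⟨t⟩`, then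
`0 → Fun(Q') → Fun(Q) → Fun(Q) → 0`, with second map `t - 1`, is exact
(`translationComplex_shortExact`). By the long exact sequence, if `kₙ` is the dimension of the
kernel of `t - 1` on `Hⁿ(G, Fun(Q))`, then `Hⁿ⁺¹(G, Fun(Q'))` has dimension `kₙ + kₙ₊₁`
(`HasCohomologyDim.succ`).

This applies to the tower `G → ℤ² → ℤ → 1` that removes the centre of the Heisenberg group `G` and
then the two coordinates. Functions on `G` are acyclic by Shapiro's lemma, and functions on `1` are
the trivial representation. Naturality of the connecting homomorphism (`ActsTrivially.succ`) shows
that translations act trivially on `H⁰` and `H¹` of `Fun(ℤ²)` and on `H⁰` and `H²` of `Fun(ℤ)`.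
Hence the Betti numbers are `1, 1` for `Fun(ℤ²)` and `1, 2, 1` for `Fun(ℤ)`, and they are
`1, 1 + k₁, k₁ + 1, 1` for the trivial representation, where `k₁` is the dimension of the fixed
space of the generator of `ℤ` on `H¹(G, Fun(ℤ))`. Finally `H¹(G, ℂ) = Hom(G, ℂ)` has dimension
two, because a homomorphism to `ℂ` kills the commutators, so `k₁ = 1`.
-/

open CategoryTheory Rep groupCohomology Module

universe u

/-! ### Functions on a quotient of a group -/

section FunctionRepresentation

variable (k : Type u) {G Q Q' : Type u} [Field k] [Group G] [Group Q] [Group Q']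

/-- The right translation representation of `G` on the functions `Q → k`, for a homomorphism
`π : G →* Q`: an element `g` sends `f` to `q ↦ f (q * π g)`. -/
@[simps]
def functionRepresentation (π : G →* Q) : Representation k G (Q → k) where
  toFun g := LinearMap.funLeft k k (· * π g)
  map_one' := by ext; simp
  map_mul' g h := by ext; simp [mul_assoc]

/-- The representation `functionRepresentation` as an object of `Rep k G`. When `π` is surjective
with kernel `N`, this is the coinduced module whose cohomology is that of `N`. -/
abbrev functionRep (π : G →* Q) : Rep.{u} k G :=
  Rep.of (functionRepresentation k π)

/-- Left translation `f ↦ (q ↦ f (s * q))` by an element `s` of `Q`. -/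
noncomputable def leftTranslate (π : G →* Q) (s : Q) : functionRep k π ⟶ functionRep k π :=
  Rep.ofHom
    { LinearMap.funLeft k k (s * ·) with
      isIntertwining' := fun g => by ext; simp [mul_assoc] }

/-- Pullback of functions along `p : Q →* Q'`. -/
noncomputable def pullback (π : G →* Q) (p : Q →* Q') :
    functionRep k (p.comp π) ⟶ functionRep k π :=
  Rep.ofHom
    { LinearMap.funLeft k k p with
      isIntertwining' := fun g => by ext; simp }

variable {k}

/-- The partial sums of `u`, with the usual sign to the left of `0`, have difference `u`. -/
lemma exists_forward_difference_eq {A : Type*} [AddCommGroup A] (u : ℤ → A) :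
    ∃ F : ℤ → A, ∀ n, F (n + 1) - F n = u n := by
  refine ⟨fun n => ∑ i ∈ Finset.Ico 0 n, u i - ∑ i ∈ Finset.Ico n 0, u i, fun n => ?_⟩
  beta_reduce
  rcases le_or_gt 0 n with hn | hn
  · rw [Finset.Ico_eq_empty_of_le hn, Finset.Ico_eq_empty_of_le (by lia : (0 : ℤ) ≤ n + 1),
      ← Finset.insert_Ico_right_eq_Ico_add_one hn, Finset.sum_insert (by simp)]
    simp
  · rw [Finset.Ico_eq_empty_of_le hn.le, Finset.Ico_eq_empty_of_le (by lia : n + 1 ≤ (0 : ℤ)),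
      ← Finset.insert_Ico_add_one_left_eq_Ico hn, Finset.sum_insert (by simp)]
    simp

/-- `p` is a surjection whose kernel is infinite cyclic, generated by `t`. -/
structure IsInfiniteCyclicKernel (p : Q →* Q') (t : Q) : Prop where
  surjective : Function.Surjective p
  ker_eq : p.ker = Subgroup.zpowers t
  zpow_injective : Function.Injective fun n : ℤ => t ^ n

variable {p : Q →* Q'} {t : Q}

lemma IsInfiniteCyclicKernel.map_generator (h : IsInfiniteCyclicKernel p t) : p t = 1 := by
  rw [← MonoidHom.mem_ker, h.ker_eq]
  exact Subgroup.mem_zpowers t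

/-- The sequence `Fun(Q') → Fun(Q) → Fun(Q)` whose maps are pullback along `p` and `t - 1`. -/
noncomputable abbrev translationComplex (π : G →* Q) (h : IsInfiniteCyclicKernel p t) :
    ShortComplex (Rep.{u} k G) where
  X₁ := functionRep k (p.comp π)
  X₂ := functionRep k π
  X₃ := functionRep k π
  f := pullback k π p
  g := leftTranslate k π t - 𝟙 _
  zero := by
    refine Rep.hom_ext <| Representation.IntertwiningMap.ext <|
      LinearMap.ext fun f => funext fun q => ?_
    change f (p (t * q)) - f (p q) = 0
    rw [map_mul, h.map_generator, one_mul, sub_self]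

/-- The functions on `Q` invariant under left translation by `t` are those constant on the fibres of
`p`. Each fibre is a copy of `ℤ` on which `t` acts as the shift, so surjectivity of `t - 1` amounts
to solving a difference equation on every fibre. -/
lemma translationComplex_shortExact (π : G →* Q) (h : IsInfiniteCyclicKernel p t) :
    (translationComplex (k := k) π h).ShortExact where
  exact := by
    refine (ShortComplex.exact_map_iff_of_faithful _ (forget₂ (Rep.{u} k G) (ModuleCat k))).1 ?_
    rw [ShortComplex.moduleCat_exact_iff]
    intro (f : Q → k) hf
    have hinv (q : Q) : f (t * q) = f q := sub_eq_zero.1 (congr_fun hf q)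
    have hpow (n : ℤ) (q : Q) : f (t ^ n * q) = f q := by
      induction n with
      | zero => simp
      | succ n ih => rw [add_comm, zpow_one_add, mul_assoc, hinv, ih]
      | pred n ih => rw [← hinv, ← mul_assoc, ← zpow_one_add, add_sub_cancel, ih]
    refine ⟨fun q' => f (Function.surjInv h.surjective q'), funext fun q => ?_⟩
    change f (Function.surjInv h.surjective (p q)) = f q
    set r := Function.surjInv h.surjective (p q)
    have hr : q * r⁻¹ ∈ p.ker := by
      simp [r, MonoidHom.mem_ker, Function.surjInv_eq h.surjective]
    rw [h.ker_eq] at hr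
    obtain ⟨n, hn⟩ := Subgroup.mem_zpowers_iff.1 hr
    rw [← hpow n r, hn, inv_mul_cancel_right]
  mono_f := (Rep.mono_iff_injective _).2 fun f₁ f₂ hf => funext fun q' => by
    obtain ⟨q, rfl⟩ := h.surjective q'
    exact congr_fun hf q
  epi_g := (Rep.epi_iff_surjective _).2 fun (g : Q → k) => by
    have key (q : Q) : ∃ n : ℤ, t ^ n * Function.surjInv h.surjective (p q) = q := by
      have hr : q * (Function.surjInv h.surjective (p q))⁻¹ ∈ p.ker := by
        simp [MonoidHom.mem_ker, Function.surjInv_eq h.surjective]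
      rw [h.ker_eq] at hr
      obtain ⟨n, hn⟩ := Subgroup.mem_zpowers_iff.1 hr
      exact ⟨n, by rw [hn, inv_mul_cancel_right]⟩
    -- `height q` is the position of `q` in its fibre, counted from a chosen base point.
    choose height h_height using key
    choose F hF using fun q' : Q' =>
      exists_forward_difference_eq fun n : ℤ => g (t ^ n * Function.surjInv h.surjective q')
    refine ⟨fun q => F (p q) (height q), funext fun q => ?_⟩
    have hp : p (t * q) = p q := by simp [h.map_generator]
    have hstep : height (t * q) = height q + 1 := by
      apply h.zpow_injective
      apply mul_right_cancel (b := Function.surjInv h.surjective (p q))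
      change t ^ height (t * q) * _ = t ^ (height q + 1) * _
      rw [add_comm, zpow_one_add, mul_assoc, h_height, ← hp, h_height]
    change F (p (t * q)) (height (t * q)) - F (p q) (height q) = g q
    rw [hp, hstep, hF, h_height]

end FunctionRepresentation

/-! ### Dimensions of cohomology along a tower of quotients -/

section Cohomology

variable {k : Type u} {G Q Q' : Type u} [Field k] [Group G] [Group Q] [Group Q']

/-- The map on `n`-th cohomology induced by a morphism of representations. -/
noncomputable abbrev cohomologyMap {A B : Rep.{u} k G} (f : A ⟶ B) (n : ℕ) :
    groupCohomology A n ⟶ groupCohomology B n :=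
  groupCohomology.map (MonoidHom.id G) f n

lemma cohomologyMap_sub {A B : Rep.{u} k G} (f g : A ⟶ B) (n : ℕ) :
    cohomologyMap (f - g) n = cohomologyMap f n - cohomologyMap g n :=
  HomologicalComplex.homologyMap_sub (cochainsMap (MonoidHom.id G) f)
    (cochainsMap (MonoidHom.id G) g) n

lemma cohomologyMap_id (A : Rep.{u} k G) (n : ℕ) :
    cohomologyMap (𝟙 A) n = 𝟙 _ :=
  (groupCohomology.functor k G n).map_id A

/-- Dimension count along a five-term exact sequence `U → V → W → X → Y`. -/
lemma finite_and_finrank_of_exact {U V W X Y : Type*} [AddCommGroup U] [AddCommGroup V]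
    [AddCommGroup W] [AddCommGroup X] [AddCommGroup Y] [Module k U] [Module k V] [Module k W]
    [Module k X] [Module k Y] [Module.Finite k V] [Module.Finite k X]
    {a : U →ₗ[k] V} {b : V →ₗ[k] W} {c : W →ₗ[k] X} {d : X →ₗ[k] Y}
    (hab : LinearMap.range a = LinearMap.ker b) (hbc : LinearMap.range b = LinearMap.ker c)
    (hcd : LinearMap.range c = LinearMap.ker d) :
    Module.Finite k W ∧
      finrank k W + finrank k (LinearMap.range a) = finrank k V + finrank k (LinearMap.ker d) := by
  have : Module.Finite k (LinearMap.ker c) := hbc ▸ inferInstance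
  have : Module.Finite k (W ⧸ LinearMap.ker c) := .equiv c.quotKerEquivRange.symm
  have : Module.Finite k W := .of_submodule_quotient (LinearMap.ker c)
  refine ⟨this, ?_⟩
  have h₁ := LinearMap.finrank_range_add_finrank_ker b
  have h₂ := LinearMap.finrank_range_add_finrank_ker c
  rw [hbc] at h₁
  rw [hcd] at h₂
  rw [hab]
  lia

variable (k) in
/-- `HasCohomologyDim k A n d` says that `Hⁿ(G, A)` is finite-dimensional of dimension `d`. The
finiteness is part of the condition because `finrank` is `0` on infinite-dimensional spaces. -/
structure HasCohomologyDim (A : Rep.{u} k G) (n d : ℕ) : Prop where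
  finite : Module.Finite k (groupCohomology A n)
  finrank_eq : finrank k (groupCohomology A n) = d

namespace HasCohomologyDim

variable {A B : Rep.{u} k G} {n d : ℕ}

lemma of_equiv (e : groupCohomology A n ≃ₗ[k] (Fin d → k)) : HasCohomologyDim k A n d :=
  ⟨.equiv e.symm, by simp [e.finrank_eq]⟩

lemma of_iso (e : A ≅ B) (h : HasCohomologyDim k A n d) : HasCohomologyDim k B n d :=
  let e' : groupCohomology A n ≃ₗ[k] groupCohomology B n :=
    ((groupCohomology.functor k G n).mapIso e).toLinearEquiv
  have := h.finite
  ⟨.equiv e', e'.symm.finrank_eq.trans h.finrank_eq⟩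

lemma of_isZero (h : Limits.IsZero (groupCohomology A n)) : HasCohomologyDim k A n 0 :=
  have := ModuleCat.isZero_iff_subsingleton.1 h
  ⟨inferInstance, finrank_zero_of_subsingleton⟩

lemma nonempty_equiv (h : HasCohomologyDim k A n d) :
    Nonempty (groupCohomology A n ≃ₗ[k] (Fin d → k)) :=
  have := h.finite
  ⟨.ofFinrankEq _ _ (by simp [h.finrank_eq])⟩

lemma subsingleton (h : HasCohomologyDim k A n 0) : Subsingleton (groupCohomology A n) :=
  have := h.finite
  finrank_zero_iff.1 h.finrank_eq

lemma isZero (h : HasCohomologyDim k A n 0) : Limits.IsZero (groupCohomology A n) :=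
  ModuleCat.isZero_iff_subsingleton.2 h.subsingleton

end HasCohomologyDim

variable {p : Q →* Q'} {t : Q}

variable (k)

/-- Left translation by `s`, which commutes with the right translation action of `G`, induces the
identity on `Hⁿ(G, functionRep k π)`. -/
def ActsTrivially (π : G →* Q) (s : Q) (n : ℕ) : Prop :=
  cohomologyMap (leftTranslate k π s) n = 𝟙 _

variable {k} in
/-- Degrees with vanishing cohomology satisfy the triviality hypothesis vacuously. -/
lemma HasCohomologyDim.actsTrivially {π : G →* Q} {n : ℕ}
    (h : HasCohomologyDim k (functionRep k π) n 0) (s : Q) : ActsTrivially k π s n :=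
  h.isZero.eq_of_src _ _

/-- The kernel of `t - 1` on `Hⁿ(G, functionRep k π)`. -/
noncomputable abbrev translationKernel (π : G →* Q) (t : Q) (n : ℕ) :
    Submodule k (groupCohomology (functionRep k π) n) :=
  LinearMap.ker (cohomologyMap (leftTranslate k π t - 𝟙 _) n).hom

variable {k}

lemma ActsTrivially.finrank_translationKernel {π : G →* Q} {t : Q} {n d : ℕ}
    (h : ActsTrivially k π t n) (hd : HasCohomologyDim k (functionRep k π) n d) :
    finrank k (translationKernel k π t n) = d := by
  have hker : translationKernel k π t n = ⊤ := by
    rw [translationKernel, cohomologyMap_sub, h, cohomologyMap_id, sub_self]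
    exact LinearMap.ker_zero
  rw [hker, finrank_top, hd.finrank_eq]

/-- The long exact sequence of `translationComplex` splits into
`0 → coker (t - 1 | Hⁿ) → Hⁿ⁺¹(G, functionRep k (p.comp π)) → ker (t - 1 | Hⁿ⁺¹) → 0`. On the
finite-dimensional space `Hⁿ` the cokernel has the same dimension as the kernel. -/
lemma HasCohomologyDim.succ {π : G →* Q} (h : IsInfiniteCyclicKernel p t) {n d₀ d₁ : ℕ}
    (h₀ : HasCohomologyDim k (functionRep k π) n d₀)
    (h₁ : HasCohomologyDim k (functionRep k π) (n + 1) d₁) :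
    HasCohomologyDim k (functionRep k (p.comp π)) (n + 1)
      (finrank k (translationKernel k π t n) + finrank k (translationKernel k π t (n + 1))) := by
  have := h₀.finite
  have := h₁.finite
  have hX := translationComplex_shortExact (k := k) π h
  have key := finite_and_finrank_of_exact (k := k)
    (U := groupCohomology (functionRep k π) n) (V := groupCohomology (functionRep k π) n)
    (W := groupCohomology (functionRep k (p.comp π)) (n + 1))
    (X := groupCohomology (functionRep k π) (n + 1))
    (Y := groupCohomology (functionRep k π) (n + 1))
    (mapShortComplex₃_exact hX (rfl : n + 1 = n + 1)).moduleCat_range_eq_ker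
    (mapShortComplex₁_exact hX (rfl : n + 1 = n + 1)).moduleCat_range_eq_ker
    (mapShortComplex₂_exact hX (n + 1)).moduleCat_range_eq_ker
  have hrank := LinearMap.finrank_range_add_finrank_ker (K := k)
    (cohomologyMap (leftTranslate k π t - 𝟙 _) n).hom
  refine ⟨key.1, Nat.add_right_cancel <| key.2.trans ?_⟩
  rw [← hrank]
  ac_rfl

lemma HasCohomologyDim.succ_of_actsTrivially {π : G →* Q} (h : IsInfiniteCyclicKernel p t)
    {n d₀ d₁ : ℕ} (h₀ : HasCohomologyDim k (functionRep k π) n d₀) (ht₀ : ActsTrivially k π t n)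
    (h₁ : HasCohomologyDim k (functionRep k π) (n + 1) d₁) (ht₁ : ActsTrivially k π t (n + 1)) :
    HasCohomologyDim k (functionRep k (p.comp π)) (n + 1) (d₀ + d₁) := by
  rw [← ht₀.finrank_translationKernel h₀, ← ht₁.finrank_translationKernel h₁]
  exact h₀.succ h h₁

lemma HasCohomologyDim.succ_eq_zero {π : G →* Q} (h : IsInfiniteCyclicKernel p t) {n : ℕ}
    (h₀ : HasCohomologyDim k (functionRep k π) n 0)
    (h₁ : HasCohomologyDim k (functionRep k π) (n + 1) 0) :
    HasCohomologyDim k (functionRep k (p.comp π)) (n + 1) 0 :=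
  h₀.succ_of_actsTrivially h (h₀.actsTrivially t) h₁ (h₁.actsTrivially t)

/-- Triviality of a translation passes to the next stage of a tower, one degree up: when
`Hⁿ⁺¹(G, functionRep k π)` vanishes, the connecting homomorphism
`Hⁿ(G, functionRep k π) → Hⁿ⁺¹(G, functionRep k (p.comp π))` is surjective, and it is natural for
translations that commute with `t`. -/
lemma ActsTrivially.succ {π : G →* Q} (h : IsInfiniteCyclicKernel p t) {s : Q}
    (hs : Commute s t) {n : ℕ}
    (hid : ActsTrivially k π s n) (hzero : HasCohomologyDim k (functionRep k π) (n + 1) 0) :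
    ActsTrivially k (p.comp π) (p s) (n + 1) := by
  have hX := translationComplex_shortExact (k := k) π h
  let F : translationComplex (k := k) π h ⟶ translationComplex (k := k) π h :=
    { τ₁ := leftTranslate k (p.comp π) (p s)
      τ₂ := leftTranslate k π s
      τ₃ := leftTranslate k π s
      comm₁₂ := Rep.hom_ext <| Representation.IntertwiningMap.ext <|
        LinearMap.ext fun f => funext fun q => by
          change f (p s * p q) = f (p (s * q))
          rw [map_mul]
      comm₂₃ := Rep.hom_ext <| Representation.IntertwiningMap.ext <|
        LinearMap.ext fun f => funext fun q => by
          change f (s * (t * q)) - f (s * q) = f (t * (s * q)) - f (s * q)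
          rw [← mul_assoc, ← mul_assoc, hs.eq] }
  -- Surjectivity of the connecting homomorphism allows it to be cancelled below.
  have := epi_δ_of_isZero hX n hzero.isZero
  change cohomologyMap _ _ = _ at hid ⊢
  have hnat := δ_naturality hX hX F n (n + 1) rfl
  rw [← cancel_epi (δ hX n (n + 1) rfl)]
  refine hnat.trans ?_
  change cohomologyMap (leftTranslate k π s) n ≫ _ = _
  rw [hid, Category.id_comp, Category.comp_id]

variable (k) in
/-- When `π` is surjective, the invariant functions are the constants. -/
noncomputable def invariantsFunctionEquiv (π : G →* Q) (hπ : Function.Surjective π) :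
    (functionRep k π).ρ.invariants ≃ₗ[k] k where
  toFun f := f.1 1
  map_add' _ _ := rfl
  map_smul' _ _ := rfl
  invFun c := ⟨fun _ => c, fun _ => rfl⟩
  left_inv f := Subtype.ext <| funext fun q => by
    obtain ⟨g, rfl⟩ := hπ q
    simpa using (congr_fun (f.2 g) 1).symm
  right_inv _ := rfl

lemma hasCohomologyDim_functionRep_zero {π : G →* Q} (hπ : Function.Surjective π) :
    HasCohomologyDim k (functionRep k π) 0 1 :=
  .of_equiv <| (H0Iso _).toLinearEquiv ≪≫ₗ invariantsFunctionEquiv k π hπ ≪≫ₗ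
    (LinearEquiv.funUnique (Fin 1) k k).symm

lemma actsTrivially_zero {π : G →* Q} (hπ : Function.Surjective π) (s : Q) :
    ActsTrivially k π s 0 := by
  change cohomologyMap _ _ = _
  rw [← cancel_mono (H0Iso (functionRep k π)).hom, map_id_comp_H0Iso_hom, Category.id_comp,
    ← Category.comp_id (H0Iso (functionRep k π)).hom, Category.assoc]
  congr 1
  ext f : 2
  apply (invariantsFunctionEquiv k π hπ).injective
  obtain ⟨c, rfl⟩ := (invariantsFunctionEquiv k π hπ).symm.surjective f
  rfl

variable (k G) in
/-- All functions on `G`, as the representation coinduced from the trivial subgroup. -/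
def functionRepIdIsoCoind :
    functionRep k (MonoidHom.id G) ≅
      coind (⊥ : Subgroup G).subtype (Rep.trivial.{u} k (⊥ : Subgroup G) k) :=
  Rep.mkIso <| .mk
    { toFun f := ⟨f, fun g h => by simp [Subgroup.mem_bot.1 g.2]⟩
      map_add' _ _ := rfl
      map_smul' _ _ := rfl
      invFun f := f.1
      left_inv _ := rfl
      right_inv _ := rfl } fun _ => rfl

variable (k G) in
/-- Functions on `G` are acyclic, by Shapiro's lemma for the trivial subgroup. -/
lemma hasCohomologyDim_functionRep_id_succ (n : ℕ) :
    HasCohomologyDim k (functionRep k (MonoidHom.id G)) (n + 1) 0 :=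
  .of_isZero <| (isZero_groupCohomology_succ_of_subsingleton _ n).of_iso <|
    (groupCohomology.functor k G (n + 1)).mapIso (functionRepIdIsoCoind k G) ≪≫ coindIso _ (n + 1)

variable (k) in
/-- Functions on a one-element group form the trivial representation. -/
def functionRepIsoTrivial [Unique Q] (π : G →* Q) :
    functionRep k π ≅ Rep.trivial.{u} k G k :=
  Rep.mkIso <| .mk (LinearEquiv.funUnique Q k k) fun _ =>
    LinearMap.ext fun f => congr_arg f (Subsingleton.elim _ _)

end Cohomology

/-! ### Quotients and characters of the Heisenberg group -/

/-- A one-parameter subgroup consists of the powers of its value at `1`. -/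
lemma zpow_eq_of_map_add {G : Type*} [Group G] (φ : ℤ → G)
    (h : ∀ m n, φ (m + n) = φ m * φ n) (n : ℤ) : φ 1 ^ n = φ n := by
  simpa [← ofAdd_zsmul] using
    (map_zpow (MonoidHom.mk' (M := Multiplicative ℤ) (fun m => φ m.toAdd)
      fun x y => h x.toAdd y.toAdd) (.ofAdd 1) n).symm

namespace HeisenbergGroup

/-- The element of the Heisenberg group with superdiagonal entries `a`, `b` and corner entry `c`. -/
def mk (a b c : ℤ) : HeisenbergGroup :=
  ⟨⟨heisenbergMatrix a b c, heisenbergMatrix (-a) (-b) (a * b - c),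
    by rw [heisenbergMatrix_mul, ← heisenbergMatrix_zero]; congr 1 <;> ring,
    by rw [heisenbergMatrix_mul, ← heisenbergMatrix_zero]; congr 1 <;> ring⟩, a, b, c, rfl⟩

/-- The `(i, j)` matrix entry. -/
def coord (i j : Fin 3) (g : HeisenbergGroup) : ℤ :=
  (g.1 : Matrix (Fin 3) (Fin 3) ℤ) i j

@[simp] lemma coord_mk_zero_one (a b c : ℤ) : coord 0 1 (mk a b c) = a := rfl
@[simp] lemma coord_mk_one_two (a b c : ℤ) : coord 1 2 (mk a b c) = b := rfl
@[simp] lemma coord_mk_zero_two (a b c : ℤ) : coord 0 2 (mk a b c) = c := rfl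

lemma exists_eq_mk (g : HeisenbergGroup) : ∃ a b c, g = mk a b c := by
  obtain ⟨g, a, b, c, h⟩ := g
  exact ⟨a, b, c, Subtype.ext (Units.ext h)⟩

@[simp] lemma mk_mul_mk (a b c a' b' c' : ℤ) :
    mk a b c * mk a' b' c' = mk (a + a') (b + b') (c + c' + a * b') :=
  Subtype.ext <| Units.ext <| heisenbergMatrix_mul ..

lemma mk_zero : mk 0 0 0 = 1 :=
  Subtype.ext <| Units.ext heisenbergMatrix_zero

/-- The quotient by the centre, `(a, b, c) ↦ (a, b)`. -/
def quotientCenter : HeisenbergGroup →* Multiplicative (ℤ × ℤ) where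
  toFun g := .ofAdd (coord 0 1 g, coord 1 2 g)
  map_one' := by rw [← mk_zero]; rfl
  map_mul' g h := by
    obtain ⟨a, b, c, rfl⟩ := exists_eq_mk g
    obtain ⟨a', b', c', rfl⟩ := exists_eq_mk h
    rw [mk_mul_mk]
    rfl

lemma quotientCenter_surjective : Function.Surjective quotientCenter :=
  fun q => ⟨mk q.toAdd.1 q.toAdd.2 0, rfl⟩

lemma mk_zero_zero_one_zpow (n : ℤ) : mk 0 0 1 ^ n = mk 0 0 n :=
  zpow_eq_of_map_add (mk 0 0) (by simp) n

lemma commute_mk_zero_zero_one (g : HeisenbergGroup) : Commute g (mk 0 0 1) := by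
  obtain ⟨a, b, c, rfl⟩ := exists_eq_mk g
  simp [Commute, SemiconjBy, add_comm]

lemma isInfiniteCyclicKernel_quotientCenter :
    IsInfiniteCyclicKernel quotientCenter (mk 0 0 1) where
  surjective := quotientCenter_surjective
  ker_eq := by
    ext g
    obtain ⟨a, b, c, rfl⟩ := exists_eq_mk g
    simp_rw [MonoidHom.mem_ker, Subgroup.mem_zpowers_iff, mk_zero_zero_one_zpow]
    refine ⟨fun h => ?_, ?_⟩
    · obtain ⟨rfl, rfl⟩ : a = 0 ∧ b = 0 := Prod.ext_iff.1 h
      exact ⟨c, rfl⟩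
    · rintro ⟨n, hn⟩
      rw [← hn]
      rfl
  zpow_injective m n h := by
    simpa [mk_zero_zero_one_zpow] using congr_arg (coord 0 2) h

/-- The projection `(a, b) ↦ a`. -/
def fstCoord : Multiplicative (ℤ × ℤ) →* Multiplicative ℤ :=
  (AddMonoidHom.fst ℤ ℤ).toMultiplicative

lemma isInfiniteCyclicKernel_fstCoord :
    IsInfiniteCyclicKernel fstCoord (.ofAdd ((0, 1) : ℤ × ℤ)) where
  surjective q := ⟨.ofAdd (q.toAdd, 0), rfl⟩
  ker_eq := by
    ext q
    obtain ⟨⟨a, b⟩, rfl⟩ := Multiplicative.ofAdd.surjective q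
    simp_rw [MonoidHom.mem_ker, Subgroup.mem_zpowers_iff, ← ofAdd_zsmul]
    refine ⟨fun h => ⟨b, ?_⟩, ?_⟩
    · obtain rfl : a = 0 := h
      simp
    · rintro ⟨n, hn⟩
      rw [← hn]
      simp [fstCoord]
  zpow_injective m n h := by
    simp_rw [← ofAdd_zsmul] at h
    simpa using congr_arg Prod.snd (Multiplicative.ofAdd.injective h)

lemma isInfiniteCyclicKernel_one :
    IsInfiniteCyclicKernel (1 : Multiplicative ℤ →* Unit) (.ofAdd 1) where
  surjective _ := ⟨1, rfl⟩
  ker_eq := by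
    ext q
    obtain ⟨a, rfl⟩ := Multiplicative.ofAdd.surjective q
    simp_rw [Subgroup.mem_zpowers_iff, ← ofAdd_zsmul]
    simp
  zpow_injective m n h := by
    simp_rw [← ofAdd_zsmul] at h
    simpa using Multiplicative.ofAdd.injective h

/-- An additive character kills the commutator `mk 0 0 1` of `mk 1 0 0` and `mk 0 1 0`, so it is
determined by its values on these two elements. -/
lemma addMonoidHom_mk (f : Additive HeisenbergGroup →+ ℂ) (a b c : ℤ) :
    f (.ofMul (mk a b c)) = a * f (.ofMul (mk 1 0 0)) + b * f (.ofMul (mk 0 1 0)) := by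
  have hz : f (.ofMul (mk 0 0 1)) = 0 := by
    have h : mk 1 0 0 * mk 0 1 0 = mk 0 1 0 * mk 1 0 0 * mk 0 0 1 := by simp
    have h' := congr_arg (fun g => f (.ofMul g)) h
    simp only [ofMul_mul, map_add] at h'
    linear_combination -h'
  have hmk : mk a b c = mk 0 1 0 ^ b * mk 1 0 0 ^ a * mk 0 0 1 ^ c := by
    rw [mk_zero_zero_one_zpow, zpow_eq_of_map_add (fun n => mk n 0 0) (by simp),
      zpow_eq_of_map_add (fun n => mk 0 n 0) (by simp)]
    simp
  simp [hmk, ofMul_mul, ofMul_zpow, hz, add_comm]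

/-- Additive characters of the Heisenberg group are pairs of complex numbers. -/
noncomputable def addMonoidHomEquiv : (Additive HeisenbergGroup →+ ℂ) ≃ₗ[ℂ] (Fin 2 → ℂ) where
  toFun f := ![f (.ofMul (mk 1 0 0)), f (.ofMul (mk 0 1 0))]
  map_add' f g := by simp
  map_smul' r f := by simp
  invFun v :=
    { toFun := fun g => coord 0 1 g.toMul * v 0 + coord 1 2 g.toMul * v 1
      map_zero' := by
        rw [toMul_zero, ← mk_zero]
        simp
      map_add' := fun g h => by
        obtain ⟨a, b, c, hg⟩ := exists_eq_mk g.toMul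
        obtain ⟨a', b', c', hh⟩ := exists_eq_mk h.toMul
        rw [toMul_add, hg, hh, mk_mul_mk]
        push_cast [coord_mk_zero_one, coord_mk_one_two]
        ring }
  left_inv f := by
    ext g
    obtain ⟨a, b, c, rfl⟩ := exists_eq_mk g
    simp [addMonoidHom_mk f a b c]
  right_inv v := by
    ext i
    fin_cases i <;> simp

/-- `H¹` with trivial coefficients is the space of additive characters. -/
noncomputable def groupCohomologyOneEquiv :
    groupCohomology (Rep.trivial ℂ HeisenbergGroup ℂ) 1 ≃ₗ[ℂ] (Fin 2 → ℂ) :=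
  (H1IsoOfIsTrivial (Rep.trivial ℂ HeisenbergGroup ℂ)).toLinearEquiv ≪≫ₗ addMonoidHomEquiv

/-! ### Cohomology of the Heisenberg group -/

lemma hasCohomologyDim_quotientCenter_one :
    HasCohomologyDim ℂ (functionRep ℂ quotientCenter) 1 1 :=
  .succ_of_actsTrivially (π := MonoidHom.id _) isInfiniteCyclicKernel_quotientCenter
    (hasCohomologyDim_functionRep_zero Function.surjective_id)
    (actsTrivially_zero Function.surjective_id _)
    (hasCohomologyDim_functionRep_id_succ ℂ _ 0)
    ((hasCohomologyDim_functionRep_id_succ ℂ _ 0).actsTrivially _)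

lemma hasCohomologyDim_quotientCenter_add_two (n : ℕ) :
    HasCohomologyDim ℂ (functionRep ℂ quotientCenter) (n + 2) 0 :=
  .succ_eq_zero (π := MonoidHom.id _) isInfiniteCyclicKernel_quotientCenter
    (hasCohomologyDim_functionRep_id_succ ℂ _ n)
    (hasCohomologyDim_functionRep_id_succ ℂ _ (n + 1))

lemma actsTrivially_quotientCenter_one (s : Multiplicative (ℤ × ℤ)) :
    ActsTrivially ℂ quotientCenter s 1 := by
  obtain ⟨g, rfl⟩ := quotientCenter_surjective s
  exact .succ (π := MonoidHom.id _) isInfiniteCyclicKernel_quotientCenter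
    (commute_mk_zero_zero_one g) (actsTrivially_zero Function.surjective_id _)
    (hasCohomologyDim_functionRep_id_succ ℂ _ 0)

/-- The homomorphism `(a, b, c) ↦ a`, whose kernel is free abelian of rank two. -/
abbrev upperCoord : HeisenbergGroup →* Multiplicative ℤ := fstCoord.comp quotientCenter

lemma upperCoord_surjective : Function.Surjective upperCoord :=
  isInfiniteCyclicKernel_fstCoord.surjective.comp quotientCenter_surjective

lemma hasCohomologyDim_upperCoord_one : HasCohomologyDim ℂ (functionRep ℂ upperCoord) 1 2 :=
  .succ_of_actsTrivially isInfiniteCyclicKernel_fstCoord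
    (hasCohomologyDim_functionRep_zero quotientCenter_surjective)
    (actsTrivially_zero quotientCenter_surjective _)
    hasCohomologyDim_quotientCenter_one (actsTrivially_quotientCenter_one _)

lemma hasCohomologyDim_upperCoord_two : HasCohomologyDim ℂ (functionRep ℂ upperCoord) 2 1 :=
  .succ_of_actsTrivially isInfiniteCyclicKernel_fstCoord
    hasCohomologyDim_quotientCenter_one (actsTrivially_quotientCenter_one _)
    (hasCohomologyDim_quotientCenter_add_two 0)
    ((hasCohomologyDim_quotientCenter_add_two 0).actsTrivially _)

lemma hasCohomologyDim_upperCoord_add_three (n : ℕ) :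
    HasCohomologyDim ℂ (functionRep ℂ upperCoord) (n + 3) 0 :=
  .succ_eq_zero isInfiniteCyclicKernel_fstCoord
    (hasCohomologyDim_quotientCenter_add_two n) (hasCohomologyDim_quotientCenter_add_two (n + 1))

lemma actsTrivially_upperCoord_two (s : Multiplicative ℤ) : ActsTrivially ℂ upperCoord s 2 := by
  obtain ⟨q, rfl⟩ := isInfiniteCyclicKernel_fstCoord.surjective s
  exact .succ isInfiniteCyclicKernel_fstCoord (Commute.all _ _)
    (actsTrivially_quotientCenter_one q) (hasCohomologyDim_quotientCenter_add_two 0)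

/-- The generator of `ℤ` does not act trivially on `H¹(G, functionRep ℂ upperCoord)`. The dimension
of its fixed space there is read off from the known `H¹` with trivial coefficients, and the same
number then enters `H²`. -/
lemma hasCohomologyDim_trivial_two :
    HasCohomologyDim ℂ (Rep.trivial ℂ HeisenbergGroup ℂ) 2 2 := by
  have h₁ := HasCohomologyDim.succ isInfiniteCyclicKernel_one
    (hasCohomologyDim_functionRep_zero upperCoord_surjective) hasCohomologyDim_upperCoord_one
  have h₂ := HasCohomologyDim.succ isInfiniteCyclicKernel_one
    hasCohomologyDim_upperCoord_one hasCohomologyDim_upperCoord_two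
  rw [(actsTrivially_zero upperCoord_surjective _).finrank_translationKernel
    (hasCohomologyDim_functionRep_zero upperCoord_surjective)] at h₁
  -- `h₁` computes the dimension of `H¹` as one plus that of the fixed space, and it is two.
  have hone := (h₁.of_iso (functionRepIsoTrivial ℂ _)).finrank_eq.symm.trans
    (groupCohomologyOneEquiv.finrank_eq.trans (finrank_fin_fun _))
  have hker : finrank ℂ (translationKernel ℂ upperCoord (.ofAdd 1) 1) = 1 :=
    Nat.add_left_cancel (hone : 1 + _ = 1 + 1)
  rw [hker, (actsTrivially_upperCoord_two _).finrank_translationKernel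
    hasCohomologyDim_upperCoord_two] at h₂
  exact h₂.of_iso (functionRepIsoTrivial ℂ _)

lemma hasCohomologyDim_trivial_three :
    HasCohomologyDim ℂ (Rep.trivial ℂ HeisenbergGroup ℂ) 3 1 :=
  .of_iso (functionRepIsoTrivial ℂ _) <| .succ_of_actsTrivially isInfiniteCyclicKernel_one
    hasCohomologyDim_upperCoord_two (actsTrivially_upperCoord_two _)
    (hasCohomologyDim_upperCoord_add_three 0)
    ((hasCohomologyDim_upperCoord_add_three 0).actsTrivially _)

lemma hasCohomologyDim_trivial_add_four (n : ℕ) :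
    HasCohomologyDim ℂ (Rep.trivial ℂ HeisenbergGroup ℂ) (n + 4) 0 :=
  .of_iso (functionRepIsoTrivial ℂ _) <| .succ_eq_zero isInfiniteCyclicKernel_one
    (hasCohomologyDim_upperCoord_add_three n) (hasCohomologyDim_upperCoord_add_three (n + 1))

end HeisenbergGroup

open HeisenbergGroup

theorem proposition33 :
    Nonempty (groupCohomology (Rep.trivial ℂ HeisenbergGroup ℂ) 0 ≃ₗ[ℂ] ℂ) ∧
    Nonempty (groupCohomology (Rep.trivial ℂ HeisenbergGroup ℂ) 1 ≃ₗ[ℂ] (Fin 2 → ℂ)) ∧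
    Nonempty (groupCohomology (Rep.trivial ℂ HeisenbergGroup ℂ) 2 ≃ₗ[ℂ] (Fin 2 → ℂ)) ∧
    Nonempty (groupCohomology (Rep.trivial ℂ HeisenbergGroup ℂ) 3 ≃ₗ[ℂ] ℂ) ∧
    ∀ n : ℕ, 3 < n → Subsingleton (groupCohomology (Rep.trivial ℂ HeisenbergGroup ℂ) n) := by
  refine ⟨⟨(H0IsoOfIsTrivial _).toLinearEquiv⟩, ⟨groupCohomologyOneEquiv⟩,
    hasCohomologyDim_trivial_two.nonempty_equiv,
    hasCohomologyDim_trivial_three.nonempty_equiv.map (· ≪≫ₗ LinearEquiv.funUnique (Fin 1) ℂ ℂ),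
    fun n hn => ?_⟩
  obtain ⟨m, rfl⟩ := Nat.exists_eq_add_of_le' hn
  exact (hasCohomologyDim_trivial_add_four m).subsingleton
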